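/- Let $\rho:\mathbb R\to\mathbb R$ be a continuous function that is not affine, and suppose that $\rho$ is continuously differentiable at some point $c\in\mathbb R$ (that is, differentiable in a neighbourhood of $c$ with $\rho'$ continuous at $c$) with $\rho'(c)\neq 0$. Let $n,m\ge 0$ and $r\ge 1$ be integers, put $N=n+m+2$, and let $K\subset\mathbb R^n$ be compact. Consider the functions $F:\mathbb R^n\to\mathbb R^m$ of the form $$F=\pi\circ A_{L+1}\circ\rho\circ A_{L}\circ\rho\circ\cdots\circ\rho\circ A_1\circ\iota,\qquad L\ge 0,$$ where $\rho$ acts entrywise, $\iota(x)=(x,0)\in\mathbb R^N$ is padding by zeros, $\pi:\mathbb R^N\to\mathbb R^m$ selects the first $m$ coordinates, and every layer is an affine map $A_l(z)=(\alpha_l I_N+U_lV_l^{\top})z+b_l$ with $\alpha_l\in\mathbb R$, $U_l,V_l\in\mathbb R^{N\times r}$ and $b_l\in\mathbb R^N$ (so $U_lV_l^\top$ has rank at most $r$). These are deep networks of arbitrary depth and constant width $N=n+m+2$, all of whose weight matrices are diagonal plus low rank (DLoR); in particular they are among the networks in which only the hidden-to-hidden weight matrices are DLoR and the input and output matrices are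 arbitrary. Then the restrictions to $K$ of such functions are dense in $C(K,\mathbb R^m)$ with respect to the uniform norm. -/

import Mathlib

/-- A layer of width `N` whose weight matrix is a diagonal-plus-low-rank (DLoR) component
`α I_N + U Vᵀ` with `U, V ∈ ℝ^{N × r}` (so that `U Vᵀ` has rank at most `r`), together with a
bias vector. -/
structure DLoRLayer (N r : ℕ) where
  α : ℝ
  U : Matrix (Fin N) (Fin r) ℝ
  V : Matrix (Fin N) (Fin r) ℝ
  bias : Fin N → ℝ

namespace DLoRLayer

/-- The weight matrix `α I_N + U Vᵀ`. -/
def weight {N r : ℕ} (l : DLoRLayer N r) : Matrix (Fin N) (Fin N) ℝ :=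
  l.α • (1 : Matrix (Fin N) (Fin N) ℝ) + l.U * l.V.transpose

/-- The affine map `z ↦ (α I_N + U Vᵀ) z + b`. -/
def affine {N r : ℕ} (l : DLoRLayer N r) (z : Fin N → ℝ) : Fin N → ℝ :=
  l.weight.mulVec z + l.bias

/-- The layer map `z ↦ ρ((α I_N + U Vᵀ) z + b)`, with `ρ` acting entrywise. -/
def activate {N r : ℕ} (ρ : ℝ → ℝ) (l : DLoRLayer N r) (z : Fin N → ℝ) : Fin N → ℝ :=
  fun i => ρ (l.affine z i)

end DLoRLayer

/-- A deep DLoR network of width `N`: a list of hidden layers (first layer first) of arbitrary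
length, and a final layer that is applied without activation. -/
structure DLoRNetwork (N r : ℕ) where
  hidden : List (DLoRLayer N r)
  output : DLoRLayer N r

namespace DLoRNetwork

/-- Zero padding `x ↦ (x, 0)` from `ℝⁿ` to `ℝ^N`, where `n ≤ N`. -/
def pad {n : ℕ} (N : ℕ) (x : Fin n → ℝ) : Fin N → ℝ :=
  fun i => if h : (i : ℕ) < n then x ⟨i, h⟩ else 0

/-- The state in `ℝ^N` after all hidden layers, starting from `z`. -/
def hiddenState {N r : ℕ} (ρ : ℝ → ℝ) (net : DLoRNetwork N r) (z : Fin N → ℝ) : Fin N → ℝ :=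
  net.hidden.foldl (fun s l => l.activate ρ s) z

/-- The function `ℝⁿ → ℝᵐ` computed by the network of width `N = n + m + 2` with activation `ρ`:
the input is padded with zeros to a vector in `ℝ^N`, the hidden layers and then the activation-free
output layer are applied, and the first `m` coordinates of the result are returned.
All weight matrices are DLoR components, those of the first and the last layer included. Since the
padding can be absorbed into the first weight matrix and the selection of coordinates into the last
one, these networks are among those with unrestricted input and output matrices. -/
def realize {n m r : ℕ} (ρ : ℝ → ℝ) (net : DLoRNetwork (n + m + 2) r) (x : Fin n → ℝ) :
    Fin m → ℝ :=
  fun j => net.output.affine (net.hiddenState ρ (pad (n + m + 2) x)) (Fin.castLE (by omega) j)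

end DLoRNetwork

/-- The elements of `C(K, ℝᵐ)` that are restrictions to `K ⊆ ℝⁿ` of functions computed by deep DLoR
networks with activation `ρ`, of width `n + m + 2` and rank parameter `r`. -/
def deepDLoRClass {n : ℕ} (m r : ℕ) (ρ : ℝ → ℝ) (K : Set (Fin n → ℝ)) :
    Set C(K, Fin m → ℝ) :=
  {g | ∃ net : DLoRNetwork (n + m + 2) r, ∀ x : K, g x = net.realize ρ (x : Fin n → ℝ)}

/-!
The coordinates of `ℝ^(n+m+2)` serve as registers: `n` for the input `x`, `m` for the output, one
auxiliary register and one scratch coordinate `τ`. Every step below is realized by layers whose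
weight matrix is `α I + u vᵀ`, up to an arbitrarily small error.

* Affine layers compose. Since `ρ` is differentiable at `c` with nonzero derivative,
  `t ↦ ρ (h t + c)` is for small `h` close to an invertible affine map, so that the activation
  between two affine layers can be neutralized by scalar rescalings, which keep a matrix
  diagonal-plus-low-rank. The same can be done on all coordinates but one
  (`admissible_update_activation`).
* Shears. Through the scratch coordinate, `z i += a ρ (w ⬝ z + b)` can be performed
  (`admissible_shear_ridge`). If `w` vanishes at `i` and `τ`, these add up, so `ρ` may be replaced
  by any locally uniform limit of combinations of functions `t ↦ ρ (w t + b)`. The square is such a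
  limit for every continuous `ρ` that is not affine (`sq_mem_ridgeClosure`): a twofold moving
  integral of `ρ` is twice differentiable with nonzero second derivative somewhere. By polarization
  `z i += a z j z k` can be performed for `j` and `k` different from `i` and `τ`.
* Polynomials. If multiples of `f x` can be added to every register, then so can multiples of
  `f x * x k`: as in the Ben-Or–Cleve evaluation of formulas with few registers, the commutator of
  `z i -= a z j (x k)` and `z j += f x` adds `a (f x) (x k)` to `z i` and restores `z j`
  (`Addable.mul_coord`). Two registers suffice, and by induction all polynomials in `x` can be added
  to every output.

A permutation of the coordinates is a product of transpositions `I - d dᵀ`, so that the outputs can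
be moved to the front, and the Stone–Weierstrass theorem concludes.
-/

open Set Filter Topology

/-! ### The square as a limit of combinations of dilated and translated activations -/

/-- The span of the functions `t ↦ ρ (w t + b)`. -/
def ridgeSpan (ρ : ℝ → ℝ) : Submodule ℝ (ℝ → ℝ) :=
  Submodule.span ℝ (range fun p : ℝ × ℝ => fun t => ρ (p.1 * t + p.2))

/-- The functions on `ℝ` that are limits, uniformly on bounded intervals, of linear combinations of
functions `t ↦ ρ (w t + b)`. -/
def ridgeClosure (ρ : ℝ → ℝ) : Submodule ℝ (ℝ → ℝ) where
  carrier := {g | ∀ R : ℝ, ∀ ε > 0, ∃ f ∈ ridgeSpan ρ, ∀ t, |t| ≤ R → |f t - g t| ≤ ε}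
  zero_mem' := fun R ε hε => ⟨0, zero_mem _, fun t _ => by simpa using hε.le⟩
  add_mem' := by
    intro g g' hg hg' R ε hε
    obtain ⟨f, hf, h⟩ := hg R (ε / 2) (half_pos hε)
    obtain ⟨f', hf', h'⟩ := hg' R (ε / 2) (half_pos hε)
    refine ⟨f + f', add_mem hf hf', fun t ht => ?_⟩
    have h1 := abs_le.1 (h t ht)
    have h2 := abs_le.1 (h' t ht)
    simp only [Pi.add_apply]
    exact abs_le.2 ⟨by linarith, by linarith⟩
  smul_mem' := by
    intro a g hg R ε hε
    have ha : 0 < |a| + 1 := by positivity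
    obtain ⟨f, hf, h⟩ := hg R (ε / (|a| + 1)) (div_pos hε ha)
    refine ⟨a • f, Submodule.smul_mem _ _ hf, fun t ht => ?_⟩
    have h1 := h t ht
    simp only [Pi.smul_apply, smul_eq_mul, ← mul_sub, abs_mul]
    calc |a| * |f t - g t| ≤ (|a| + 1) * (ε / (|a| + 1)) := by
          gcongr
          linarith
      _ = ε := by field_simp

theorem mem_ridgeClosure {ρ g : ℝ → ℝ} : g ∈ ridgeClosure ρ ↔
    ∀ R : ℝ, ∀ ε > 0, ∃ f ∈ ridgeSpan ρ, ∀ t, |t| ≤ R → |f t - g t| ≤ ε :=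
  Iff.rfl

theorem self_mem_ridgeClosure (ρ : ℝ → ℝ) : ρ ∈ ridgeClosure ρ := fun _ ε hε =>
  ⟨ρ, Submodule.subset_span ⟨(1, 0), by simp⟩, fun t _ => by simpa using hε.le⟩

theorem ridgeSpan_comp_affine {ρ f : ℝ → ℝ} (hf : f ∈ ridgeSpan ρ) (w b : ℝ) :
    (fun t => f (w * t + b)) ∈ ridgeSpan ρ := by
  unfold ridgeSpan at hf
  induction hf using Submodule.span_induction with
  | mem f hf =>
    obtain ⟨p, rfl⟩ := hf
    refine Submodule.subset_span ⟨(p.1 * w, p.1 * b + p.2), ?_⟩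
    funext t
    simp only
    congr 1
    ring
  | zero => exact zero_mem (ridgeSpan ρ)
  | add f f' _ _ h h' => exact add_mem h h'
  | smul a f _ h => exact Submodule.smul_mem _ a h

theorem ridgeClosure_comp_affine {ρ g : ℝ → ℝ} (hg : g ∈ ridgeClosure ρ) (w b : ℝ) :
    (fun t => g (w * t + b)) ∈ ridgeClosure ρ := by
  intro R ε hε
  obtain ⟨f, hf, h⟩ := hg (|w| * R + |b|) ε hε
  refine ⟨_, ridgeSpan_comp_affine hf w b, fun t ht => h _ ?_⟩
  calc |w * t + b| ≤ |w * t| + |b| := abs_add_le _ _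
    _ ≤ |w| * R + |b| := by
      rw [abs_mul]
      gcongr

theorem ridgeClosure_of_limit {ρ g : ℝ → ℝ}
    (h : ∀ R : ℝ, ∀ ε > 0, ∃ f ∈ ridgeClosure ρ, ∀ t, |t| ≤ R → |f t - g t| ≤ ε) :
    g ∈ ridgeClosure ρ := by
  intro R ε hε
  obtain ⟨f, hf, h1⟩ := h R (ε / 2) (half_pos hε)
  obtain ⟨f', hf', h2⟩ := hf R (ε / 2) (half_pos hε)
  refine ⟨f', hf', fun t ht => ?_⟩
  have h3 := abs_le.1 (h1 t ht)
  have h4 := abs_le.1 (h2 t ht)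
  exact abs_le.2 ⟨by linarith, by linarith⟩

/-- The moving integral `t ↦ ∫_t^{t+h} g`. -/
noncomputable def movingIntegral (h : ℝ) (g : ℝ → ℝ) (t : ℝ) : ℝ := ∫ u in t..(t + h), g u

theorem hasDerivAt_movingIntegral {g : ℝ → ℝ} (hg : Continuous g) (h t : ℝ) :
    HasDerivAt (movingIntegral h g) (g (t + h) - g t) t := by
  have e : movingIntegral h g =
      fun t => (∫ u in (0 : ℝ)..(t + h), g u) - ∫ u in (0 : ℝ)..t, g u := by
    funext t
    exact (intervalIntegral.integral_interval_sub_left (hg.intervalIntegrable _ _)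
      (hg.intervalIntegrable _ _)).symm
  rw [e]
  refine HasDerivAt.sub ?_ (hg.integral_hasStrictDerivAt 0 t).hasDerivAt
  exact HasDerivAt.comp_add_const t h (hg.integral_hasStrictDerivAt 0 (t + h)).hasDerivAt

theorem continuous_movingIntegral {g : ℝ → ℝ} (hg : Continuous g) (h : ℝ) :
    Continuous (movingIntegral h g) :=
  continuous_iff_continuousAt.2 fun t => (hasDerivAt_movingIntegral hg h t).continuousAt

/-- Riemann sums approximate the moving integral uniformly on bounded intervals. -/
theorem movingIntegral_mem_ridgeClosure {ρ g : ℝ → ℝ} (hc : Continuous g)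
    (hg : g ∈ ridgeClosure ρ) {h : ℝ} (hh : 0 < h) : movingIntegral h g ∈ ridgeClosure ρ := by
  refine ridgeClosure_of_limit fun R ε hε => ?_
  have huc := (isCompact_Icc (a := -|R| - h) (b := |R| + h)).uniformContinuousOn_of_continuous
    hc.continuousOn
  obtain ⟨δ, hδ, H⟩ := Metric.uniformContinuousOn_iff.1 huc (ε / h) (div_pos hε hh)
  obtain ⟨k, hk⟩ := exists_nat_gt (h / δ)
  have hk0 : (0 : ℝ) < k := lt_of_le_of_lt (by positivity) hk
  have hs : 0 < h / k := div_pos hh hk0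
  have hsδ : h / k < δ := by
    rw [div_lt_iff₀ hk0]
    rw [div_lt_iff₀ hδ] at hk
    linarith
  refine ⟨fun t => ∑ i ∈ Finset.range k, (h / k) * g (t + i * (h / k)), ?_, fun t ht => ?_⟩
  · have : (fun t => ∑ i ∈ Finset.range k, (h / k) * g (t + i * (h / k)))
        = ∑ i ∈ Finset.range k, (h / k) • fun t => g (1 * t + i * (h / k)) := by
      funext t
      simp
    rw [this]
    exact Submodule.sum_mem _ fun i _ =>
      Submodule.smul_mem _ _ (ridgeClosure_comp_affine hg 1 _)
  · have hsum : movingIntegral h g t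
        = ∑ i ∈ Finset.range k, ∫ u in (t + i * (h / k))..(t + (i + 1 : ℕ) * (h / k)), g u := by
      rw [intervalIntegral.sum_integral_adjacent_intervals
        (a := fun i : ℕ => t + i * (h / k)) fun i _ => hc.intervalIntegrable _ _]
      have : (k : ℝ) * (h / k) = h := by field_simp
      simp [movingIntegral, this]
    have hR := abs_le.1 (ht.trans (le_abs_self R))
    rw [hsum, ← Finset.sum_sub_distrib]
    refine (Finset.abs_sum_le_sum_abs _ _).trans ?_
    calc ∑ i ∈ Finset.range k, |(h / k) * g (t + i * (h / k))
            - ∫ u in (t + i * (h / k))..(t + (i + 1 : ℕ) * (h / k)), g u|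
        ≤ ∑ i ∈ Finset.range k, ε / h * (h / k) := by
          refine Finset.sum_le_sum fun i hi => ?_
          have hik : ((i + 1 : ℕ) : ℝ) ≤ k := by
            exact_mod_cast Finset.mem_range.1 hi
          have hle : ((i + 1 : ℕ) : ℝ) * (h / k) ≤ h := by
            calc _ ≤ (k : ℝ) * (h / k) := by gcongr
              _ = h := by field_simp
          have hi0 : (0 : ℝ) ≤ i * (h / k) := by positivity
          push_cast at hle ⊢
          have hconst : (h / k) * g (t + i * (h / k))
              = ∫ _ in (t + i * (h / k))..(t + (i + 1) * (h / k)), g (t + i * (h / k)) := by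
            rw [intervalIntegral.integral_const, smul_eq_mul]
            ring
          rw [hconst, ← intervalIntegral.integral_sub
            (by simp) (hc.intervalIntegrable _ _)]
          have hb := intervalIntegral.norm_integral_le_of_norm_le_const
            (f := fun u => g (t + i * (h / k)) - g u)
            (a := t + i * (h / k)) (b := t + (i + 1) * (h / k)) (C := ε / h) ?_
          · rw [Real.norm_eq_abs] at hb
            refine hb.trans (le_of_eq ?_)
            rw [show t + (i + 1) * (h / k) - (t + i * (h / k)) = h / k by ring, abs_of_pos hs]
          · intro u hu
            rw [uIoc_of_le (by linarith)] at hu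
            refine (H _ ⟨by linarith, by linarith⟩ u ⟨by linarith [hu.1], by linarith [hu.2]⟩ ?_).le
            rw [Real.dist_eq, abs_lt]
            exact ⟨by linarith [hu.2], by linarith [hu.1]⟩
      _ = ε := by
          rw [Finset.sum_const, Finset.card_range, nsmul_eq_mul]
          field_simp

/-- The symmetric second difference quotient converges to the second derivative. -/
theorem abs_symmetric_second_difference_le {f f' : ℝ → ℝ} (hf : ∀ t, HasDerivAt f (f' t) t)
    {a d : ℝ} (hf' : HasDerivAt f' d a) {ε : ℝ} (hε : 0 < ε) :
    ∃ δ > 0, ∀ s, |s| ≤ δ → |f (a + s) + f (a - s) - 2 * f a - d * s ^ 2| ≤ ε * s ^ 2 := by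
  have ho := hasDerivAt_iff_isLittleO_nhds_zero.1 hf'
  obtain ⟨δ, hδ, H⟩ := Metric.eventually_nhds_iff.1 (ho.bound (half_pos hε))
  refine ⟨δ / 2, half_pos hδ, fun s hs => ?_⟩
  set G : ℝ → ℝ := fun s => f (a + s) + f (a - s) - 2 * f a - d * s ^ 2 with hG
  have hG' : ∀ s, HasDerivAt G (f' (a + s) - f' (a - s) - 2 * d * s) s := by
    intro s
    have h1 := HasDerivAt.comp_const_add a s (hf (a + s))
    have h2 := HasDerivAt.comp_const_sub a s (hf (a - s))
    have h3 := ((hasDerivAt_id s).pow 2).const_mul d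
    refine (((h1.add h2).sub_const (2 * f a)).sub h3).congr_deriv ?_
    simp
    ring
  have hb : ∀ x ∈ Icc (-|s|) |s|, ‖f' (a + x) - f' (a - x) - 2 * d * x‖ ≤ ε * |s| := by
    intro x hx
    have hxs : |x| ≤ |s| := abs_le.2 hx
    have h1 := @H x (by rw [Real.dist_eq, sub_zero]; linarith)
    have h2 := @H (-x) (by rw [Real.dist_eq, sub_zero, abs_neg]; linarith)
    simp only [smul_eq_mul, Real.norm_eq_abs, abs_neg] at h1 h2 ⊢
    rw [← sub_eq_add_neg] at h2
    have h3 := abs_le.1 h1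
    have h4 := abs_le.1 h2
    have h5 : ε * |x| ≤ ε * |s| := by gcongr
    exact abs_le.2 ⟨by linarith, by linarith⟩
  have := (convex_Icc (-|s|) |s|).norm_image_sub_le_of_norm_hasDerivWithin_le
    (fun x _ => (hG' x).hasDerivWithinAt) hb
    (x := 0) (y := s) ⟨by simp, by simp⟩ ⟨neg_abs_le s, le_abs_self s⟩
  have h0 : G 0 = 0 := by simp [hG]; ring
  rw [h0, sub_zero, sub_zero, Real.norm_eq_abs, Real.norm_eq_abs, mul_assoc, ← sq, sq_abs] at this
  exact this

theorem exists_second_difference_ne_zero {ρ : ℝ → ℝ} (hc : Continuous ρ)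
    (hna : ¬ ∃ a b : ℝ, ∀ x : ℝ, ρ x = a * x + b) :
    ∃ t h : ℝ, 0 < h ∧ ρ (t + h + h) - ρ (t + h) - (ρ (t + h) - ρ t) ≠ 0 := by
  by_contra! H
  have H' : ∀ x y : ℝ, x < y → ρ (midpoint ℝ x y) = midpoint ℝ (ρ x) (ρ y) := by
    intro x y hxy
    have h := H x ((y - x) / 2) (by linarith)
    rw [show x + (y - x) / 2 + (y - x) / 2 = y by ring,
      show x + (y - x) / 2 = (x + y) / 2 by ring] at h
    rw [midpoint_eq_smul_add, midpoint_eq_smul_add, smul_eq_mul, smul_eq_mul, invOf_eq_inv,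
      show (2 : ℝ)⁻¹ * (x + y) = (x + y) / 2 by ring]
    linarith
  let A : ℝ →ᵃ[ℝ] ℝ := AffineMap.ofMapMidpoint ρ (fun x y => by
    rcases lt_trichotomy x y with h | rfl | h
    · exact H' x y h
    · simp
    · rw [midpoint_comm, H' y x h, midpoint_comm]) hc
  refine hna ⟨A.linear 1, ρ 0, fun x => ?_⟩
  have h1 := A.map_vadd 0 x
  have h2 : A.linear x = x * A.linear 1 := by
    rw [← smul_eq_mul, ← map_smul, smul_eq_mul, mul_one]
  simp only [vadd_eq_add, add_zero] at h1
  rw [h2] at h1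
  have h3 : ∀ y, A y = ρ y := fun y => rfl
  rw [h3, h3] at h1
  linarith

/-- A twofold moving integral `σ` of `ρ` is a limit of combinations of translates of `ρ`, and its
second derivative is a second difference of `ρ`, hence is nonzero at some `a`. The functions
`η⁻² (σ (a + η t) + σ (a - η t) - 2 σ a)` converge to `σ'' a * t ^ 2`. -/
theorem sq_mem_ridgeClosure {ρ : ℝ → ℝ} (hc : Continuous ρ)
    (hna : ¬ ∃ a b : ℝ, ∀ x : ℝ, ρ x = a * x + b) :
    (fun t : ℝ => t ^ 2) ∈ ridgeClosure ρ := by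
  obtain ⟨a, h, hh, hd⟩ := exists_second_difference_ne_zero hc hna
  set d := ρ (a + h + h) - ρ (a + h) - (ρ (a + h) - ρ a) with hd_def
  set q := movingIntegral h ρ with hq
  have hqc : Continuous q := continuous_movingIntegral hc h
  set σ := movingIntegral h q with hσ
  have hσmem : σ ∈ ridgeClosure ρ :=
    movingIntegral_mem_ridgeClosure hqc
      (movingIntegral_mem_ridgeClosure hc (self_mem_ridgeClosure ρ) hh) hh
  have hσ1 : ∀ t, HasDerivAt σ (q (t + h) - q t) t := hasDerivAt_movingIntegral hqc h
  have hσ2 : HasDerivAt (fun t => q (t + h) - q t) d a :=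
    (HasDerivAt.comp_add_const a h (hasDerivAt_movingIntegral hc h (a + h))).sub
      (hasDerivAt_movingIntegral hc h a)
  suffices hs : (fun t : ℝ => d * t ^ 2) ∈ ridgeClosure ρ by
    have := Submodule.smul_mem _ d⁻¹ hs
    convert this using 1
    funext t
    simp only [Pi.smul_apply, smul_eq_mul]
    field_simp
  refine ridgeClosure_of_limit fun R ε hε => ?_
  have hR : 0 < |R| + 1 := by positivity
  obtain ⟨δ, hδ, H⟩ := abs_symmetric_second_difference_le hσ1 hσ2
    (ε := ε / (|R| + 1) ^ 2) (by positivity)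
  set η := δ / (|R| + 1) with hη_def
  have hη : 0 < η := div_pos hδ hR
  refine ⟨η⁻¹ ^ 2 • ((fun t => σ (η * t + a)) + (fun t => σ (-η * t + a))
    - (2 : ℝ) • fun t => σ (0 * t + a)), ?_, fun t ht => ?_⟩
  · exact Submodule.smul_mem _ _ (sub_mem (add_mem (ridgeClosure_comp_affine hσmem _ _)
      (ridgeClosure_comp_affine hσmem _ _))
      (Submodule.smul_mem _ _ (ridgeClosure_comp_affine hσmem _ _)))
  · have htR : |t| ≤ |R| + 1 := by linarith [le_abs_self R]
    have h1 := H (η * t) (by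
      rw [abs_mul, abs_of_pos hη]
      calc η * |t| ≤ η * (|R| + 1) := by gcongr
        _ = δ := by rw [hη_def]; field_simp)
    simp only [Pi.smul_apply, Pi.add_apply, Pi.sub_apply, smul_eq_mul]
    rw [show -η * t + a = a - η * t by ring, show η * t + a = a + η * t by ring,
      show 0 * t + a = a by ring,
      show η⁻¹ ^ 2 * (σ (a + η * t) + σ (a - η * t) - 2 * σ a) - d * t ^ 2
        = η⁻¹ ^ 2 * (σ (a + η * t) + σ (a - η * t) - 2 * σ a - d * (η * t) ^ 2) by field_simp,
      abs_mul, abs_of_pos (by positivity : 0 < η⁻¹ ^ 2)]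
    calc η⁻¹ ^ 2 * |σ (a + η * t) + σ (a - η * t) - 2 * σ a - d * (η * t) ^ 2|
        ≤ η⁻¹ ^ 2 * (ε / (|R| + 1) ^ 2 * (η * t) ^ 2) := by gcongr
      _ = ε / (|R| + 1) ^ 2 * |t| ^ 2 := by rw [sq_abs]; field_simp
      _ ≤ ε / (|R| + 1) ^ 2 * (|R| + 1) ^ 2 := by gcongr
      _ = ε := by field_simp

/-! ### Layers of rank one -/

namespace DLoRLayer

variable {N r : ℕ}

/-- The layer with weight matrix `α I + u vᵀ`; the remaining columns of `U` and `V` are zero. -/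
def rankOne (r : ℕ) (α : ℝ) (u v b : Fin N → ℝ) : DLoRLayer N r where
  α := α
  U := Matrix.of fun i k => if (k : ℕ) = 0 then u i else 0
  V := Matrix.of fun i k => if (k : ℕ) = 0 then v i else 0
  bias := b

theorem affine_eq (l : DLoRLayer N r) (z : Fin N → ℝ) :
    l.affine z = l.α • z + l.U.mulVec (l.V.transpose.mulVec z) + l.bias := by
  simp [affine, weight, Matrix.add_mulVec, Matrix.smul_mulVec]

theorem rankOne_affine (hr : 1 ≤ r) (α : ℝ) (u v b z : Fin N → ℝ) :
    (rankOne r α u v b).affine z = fun i => α * z i + u i * (v ⬝ᵥ z) + b i := by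
  obtain ⟨r, rfl⟩ := Nat.exists_eq_succ_of_ne_zero (Nat.one_le_iff_ne_zero.1 hr)
  rw [affine_eq]
  funext i
  simp [rankOne, Matrix.mulVec, dotProduct, -Matrix.mulVec_mulVec]

/-- The layer whose affine map is `z ↦ a • l z + d`. -/
def rescale (l : DLoRLayer N r) (a : ℝ) (d : Fin N → ℝ) : DLoRLayer N r where
  α := a * l.α
  U := a • l.U
  V := l.V
  bias := a • l.bias + d

theorem rescale_affine (l : DLoRLayer N r) (a : ℝ) (d z : Fin N → ℝ) :
    (l.rescale a d).affine z = a • l.affine z + d := by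
  simp only [affine_eq, rescale, Matrix.smul_mulVec, smul_add, smul_smul, add_assoc]

/-- The layer whose affine map is `z ↦ l (a • z + d)`. -/
def precomp (l : DLoRLayer N r) (a : ℝ) (d : Fin N → ℝ) : DLoRLayer N r where
  α := a * l.α
  U := a • l.U
  V := l.V
  bias := l.affine d

theorem precomp_affine (l : DLoRLayer N r) (a : ℝ) (d z : Fin N → ℝ) :
    (l.precomp a d).affine z = l.affine (a • z + d) := by
  simp only [affine_eq, precomp, Matrix.smul_mulVec, smul_add, smul_smul, Matrix.mulVec_add,
    Matrix.mulVec_smul]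
  rw [mul_comm a]
  abel

theorem continuous_affine (l : DLoRLayer N r) : Continuous l.affine := by
  unfold affine
  fun_prop

end DLoRLayer

namespace DLoRNetwork

variable {N r : ℕ}

/-- The state in `ℝ^N` after the output layer. -/
def eval (ρ : ℝ → ℝ) (net : DLoRNetwork N r) (z : Fin N → ℝ) : Fin N → ℝ :=
  net.output.affine (net.hiddenState ρ z)

theorem continuous_pad {n : ℕ} (N : ℕ) : Continuous (pad (n := n) N) := by
  refine continuous_pi fun i => ?_
  unfold pad
  split_ifs
  · exact continuous_apply _
  · exact continuous_const

theorem continuous_eval {ρ : ℝ → ℝ} (hρ : Continuous ρ) (net : DLoRNetwork N r) :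
    Continuous (net.eval ρ) := by
  have key : ∀ (L : List (DLoRLayer N r)) (f : (Fin N → ℝ) → Fin N → ℝ), Continuous f →
      Continuous fun z => L.foldl (fun s l => l.activate ρ s) (f z) := by
    intro L
    induction L with
    | nil => exact fun f hf => hf
    | cons l L ih =>
      intro f hf
      simp only [List.foldl_cons]
      refine ih (fun z => l.activate ρ (f z)) ?_
      have := l.continuous_affine.comp hf
      exact continuous_pi fun i => hρ.comp ((continuous_apply i).comp this)
  exact net.output.continuous_affine.comp (key net.hidden _ continuous_id)

/-- The network that feeds the state after the output layer through the activation, and then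
through the layer `B`. -/
def snoc (net : DLoRNetwork N r) (B : DLoRLayer N r) : DLoRNetwork N r :=
  ⟨net.hidden ++ [net.output], B⟩

theorem snoc_eval (ρ : ℝ → ℝ) (net : DLoRNetwork N r) (B : DLoRLayer N r) (z : Fin N → ℝ) :
    (net.snoc B).eval ρ z = B.affine fun i => ρ (net.eval ρ z i) := by
  simp [snoc, eval, hiddenState]
  rfl

end DLoRNetwork

/-! ### Operations on the state -/

/-- `F` is bounded on `S`, and it is a uniform limit on `S` of state maps of DLoR networks. -/
def Realizable {N : ℕ} (ρ : ℝ → ℝ) (r : ℕ) (S : Set (Fin N → ℝ))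
    (F : (Fin N → ℝ) → Fin N → ℝ) : Prop :=
  (∃ M, ∀ z ∈ S, ‖F z‖ ≤ M) ∧
    ∀ ε > 0, ∃ net : DLoRNetwork N r, ∀ z ∈ S, ‖net.eval ρ z - F z‖ ≤ ε

/-- The operation `T` on states can be appended to every realizable map. Defined this way,
admissible operations compose by definition. -/
def Admissible {N : ℕ} (ρ : ℝ → ℝ) (r : ℕ) (T : (Fin N → ℝ) → Fin N → ℝ) : Prop :=
  ∀ S F, Realizable ρ r S F → Realizable ρ r S fun z => T (F z)

/-- Unlike in `Metric.uniformContinuousOn_iff`, only one of the two points is assumed to lie in the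
ball, so that it applies to approximants of a bounded map. -/
theorem Continuous.exists_modulus {E E' : Type*} [NormedAddCommGroup E] [ProperSpace E]
    [NormedAddCommGroup E'] {T : E → E'} (hT : Continuous T) (M : ℝ) {ε : ℝ} (hε : 0 < ε) :
    ∃ δ > 0, ∀ z w, ‖z‖ ≤ M → ‖w - z‖ ≤ δ → ‖T w - T z‖ ≤ ε := by
  have huc := (isCompact_closedBall (0 : E) (M + 1)).uniformContinuousOn_of_continuous
    hT.continuousOn
  obtain ⟨δ, hδ, H⟩ := Metric.uniformContinuousOn_iff.1 huc ε hε
  refine ⟨min (δ / 2) 1, by positivity, fun z w hz hw => ?_⟩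
  have hw1 : ‖w - z‖ ≤ 1 := hw.trans (min_le_right _ _)
  have hw2 : ‖w - z‖ ≤ δ / 2 := hw.trans (min_le_left _ _)
  have hwM : ‖w‖ ≤ M + 1 := by
    calc ‖w‖ = ‖z + (w - z)‖ := by rw [add_sub_cancel]
      _ ≤ ‖z‖ + ‖w - z‖ := norm_add_le _ _
      _ ≤ M + 1 := by linarith
  rw [← dist_eq_norm]
  refine (H w (by simpa using hwM) z (by simpa using by linarith) ?_).le
  rw [dist_eq_norm]
  linarith

theorem Continuous.exists_norm_le {E E' : Type*} [NormedAddCommGroup E] [ProperSpace E]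
    [NormedAddCommGroup E'] {T : E → E'} (hT : Continuous T) (M : ℝ) :
    ∃ M', ∀ z, ‖z‖ ≤ M → ‖T z‖ ≤ M' := by
  obtain ⟨C, hC⟩ := (isCompact_closedBall (0 : E) M).exists_bound_of_continuousOn hT.continuousOn
  exact ⟨C, fun z hz => hC z (by simpa using hz)⟩

/-- Near a point of differentiability with nonzero derivative, `ρ` is up to affine changes of
variables close to the identity on every bounded interval. -/
theorem exists_identity_approx {ρ : ℝ → ℝ} {c : ℝ} (hd : DifferentiableAt ℝ ρ c)
    (hne : deriv ρ c ≠ 0) (M : ℝ) {ε : ℝ} (hε : 0 < ε) :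
    ∃ h a b : ℝ, ∀ t, |t| ≤ M → |a * ρ (h * t + c) + b - t| ≤ ε := by
  have ho := hasDerivAt_iff_isLittleO_nhds_zero.1 hd.hasDerivAt
  set D := deriv ρ c
  have hM : 0 < |M| + 1 := by positivity
  have hD : 0 < |D| := abs_pos.2 hne
  obtain ⟨δ, hδ, H⟩ := Metric.eventually_nhds_iff.1
    (ho.bound (c := ε * |D| / (|M| + 1)) (by positivity))
  set h := δ / 2 / (|M| + 1) with hh_def
  have hh : 0 < h := by positivity
  refine ⟨h, (h * D)⁻¹, -(h * D)⁻¹ * ρ c, fun t ht => ?_⟩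
  have htM : |t| ≤ |M| + 1 := by linarith [le_abs_self M]
  have hb : |h * t| ≤ δ / 2 := by
    rw [abs_mul, abs_of_pos hh]
    calc h * |t| ≤ h * (|M| + 1) := by gcongr
      _ = δ / 2 := by rw [hh_def]; field_simp
  have h1 := @H (h * t) (by rw [Real.dist_eq, sub_zero]; linarith)
  simp only [smul_eq_mul, Real.norm_eq_abs] at h1
  rw [show (h * D)⁻¹ * ρ (h * t + c) + -(h * D)⁻¹ * ρ c - t
    = (h * D)⁻¹ * (ρ (c + h * t) - ρ c - h * t * D) by
      rw [add_comm c]; field_simp; ring, abs_mul, abs_inv, abs_mul h D, abs_of_pos hh]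
  calc (h * |D|)⁻¹ * |ρ (c + h * t) - ρ c - h * t * D|
      ≤ (h * |D|)⁻¹ * (ε * |D| / (|M| + 1) * |h * t|) := by gcongr
    _ = ε / (|M| + 1) * |t| := by
      rw [abs_mul, abs_of_pos hh]; field_simp
    _ ≤ ε / (|M| + 1) * (|M| + 1) := by gcongr
    _ = ε := by field_simp

namespace Admissible

variable {N r : ℕ} {ρ : ℝ → ℝ}

theorem congr {T T' : (Fin N → ℝ) → Fin N → ℝ} (hT : Admissible ρ r T) (h : ∀ z, T' z = T z) :
    Admissible ρ r T' := by
  rwa [show T' = T from funext h]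

theorem comp {T T' : (Fin N → ℝ) → Fin N → ℝ} (hT : Admissible ρ r T) (hT' : Admissible ρ r T') :
    Admissible ρ r fun z => T (T' z) :=
  fun S F hF => hT S _ (hT' S F hF)

theorem of_limit {T : (Fin N → ℝ) → Fin N → ℝ}
    (h : ∀ R : ℝ, ∀ ε > 0, ∃ T', Admissible ρ r T' ∧ ∀ z, ‖z‖ ≤ R → ‖T' z - T z‖ ≤ ε) :
    Admissible ρ r T := by
  rintro S F hF
  obtain ⟨M, hM⟩ := hF.1
  refine ⟨?_, fun ε hε => ?_⟩
  · obtain ⟨T', hT', H⟩ := h M 1 one_pos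
    obtain ⟨M', hM'⟩ := (hT' S F hF).1
    refine ⟨M' + 1, fun z hz => ?_⟩
    calc ‖T (F z)‖ = ‖T' (F z) - (T' (F z) - T (F z))‖ := by rw [sub_sub_cancel]
      _ ≤ ‖T' (F z)‖ + ‖T' (F z) - T (F z)‖ := norm_sub_le _ _
      _ ≤ M' + 1 := add_le_add (hM' z hz) (H _ (hM z hz))
  · obtain ⟨T', hT', H⟩ := h M (ε / 2) (half_pos hε)
    obtain ⟨net, hnet⟩ := (hT' S F hF).2 (ε / 2) (half_pos hε)
    refine ⟨net, fun z hz => ?_⟩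
    have := norm_sub_le_norm_sub_add_norm_sub (net.eval ρ z) (T' (F z)) (T (F z))
    linarith [hnet z hz, H _ (hM z hz)]

/-- Between two affine maps the activation can be made close to the identity, so that affine
layers can be applied without activation. -/
theorem affine {c : ℝ} (hd : DifferentiableAt ℝ ρ c) (hne : deriv ρ c ≠ 0)
    (B : DLoRLayer N r) : Admissible ρ r B.affine := by
  rintro S F ⟨⟨M, hM⟩, hF⟩
  refine ⟨?_, fun ε hε => ?_⟩
  · obtain ⟨M', hM'⟩ := B.continuous_affine.exists_norm_le M
    exact ⟨M', fun z hz => hM' _ (hM z hz)⟩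
  obtain ⟨δ, hδ, hB⟩ := B.continuous_affine.exists_modulus M hε
  obtain ⟨net, hnet⟩ := hF (min (δ / 2) 1) (by positivity)
  obtain ⟨h, a, b, hid⟩ := exists_identity_approx hd hne (M + 1) (half_pos hδ)
  refine ⟨DLoRNetwork.snoc ⟨net.hidden, net.output.rescale h fun _ => c⟩
    (B.precomp a fun _ => b), fun z hz => ?_⟩
  rw [DLoRNetwork.snoc_eval, DLoRLayer.precomp_affine]
  refine hB _ _ (hM z hz) ?_
  have hn1 := (hnet z hz).trans (min_le_left _ _)
  have hn2 := (hnet z hz).trans (min_le_right _ _)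
  have hnM : ‖net.eval ρ z‖ ≤ M + 1 := by
    have := norm_add_le (F z) (net.eval ρ z - F z)
    rw [add_sub_cancel] at this
    linarith [hM z hz]
  refine (pi_norm_le_iff_of_nonneg hδ.le).2 fun i => ?_
  have h1 := hid (net.eval ρ z i) ((norm_le_pi_norm (net.eval ρ z) i).trans hnM)
  have h2 := (norm_le_pi_norm (net.eval ρ z - F z) i).trans hn1
  simp only [DLoRNetwork.eval, DLoRNetwork.hiddenState, DLoRLayer.rescale_affine, Pi.add_apply,
    Pi.sub_apply, Pi.smul_apply, smul_eq_mul, Real.norm_eq_abs] at h1 h2 ⊢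
  have h3 := abs_le.1 h1
  have h4 := abs_le.1 h2
  exact abs_le.2 ⟨by linarith, by linarith⟩

theorem rankOne {c : ℝ} (hd : DifferentiableAt ℝ ρ c) (hne : deriv ρ c ≠ 0) (hr : 1 ≤ r)
    (α : ℝ) (u v b : Fin N → ℝ) :
    Admissible ρ r fun z i => α * z i + u i * (v ⬝ᵥ z) + b i :=
  (affine hd hne (DLoRLayer.rankOne r α u v b)).congr fun z =>
    (DLoRLayer.rankOne_affine hr α u v b z).symm

theorem activation (hρ : Continuous ρ) (hr : 1 ≤ r) :
    Admissible (N := N) ρ r fun z i => ρ (z i) := by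
  rintro S F ⟨⟨M, hM⟩, hF⟩
  have hc : Continuous fun (z : Fin N → ℝ) i => ρ (z i) := by fun_prop
  refine ⟨?_, fun ε hε => ?_⟩
  · obtain ⟨M', hM'⟩ := hc.exists_norm_le M
    exact ⟨M', fun z hz => hM' _ (hM z hz)⟩
  obtain ⟨δ, hδ, hB⟩ := hc.exists_modulus M hε
  obtain ⟨net, hnet⟩ := hF δ hδ
  refine ⟨net.snoc (DLoRLayer.rankOne r 1 0 0 0), fun z hz => ?_⟩
  rw [DLoRNetwork.snoc_eval, DLoRLayer.rankOne_affine hr]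
  simpa using hB _ _ (hM z hz) (hnet z hz)

end Admissible

/-! ### Shears -/

section Shear

open Function

variable {N r : ℕ} {ρ : ℝ → ℝ} {c : ℝ}

/-- The operation `z i += g z`, after which the scratch coordinate `τ` is set to zero. -/
def shear (τ i : Fin N) (g : (Fin N → ℝ) → ℝ) (z : Fin N → ℝ) : Fin N → ℝ :=
  update (update z i (z i + g z)) τ 0

/-- The hypotheses under which all layers of rank one can be applied without activation: `ρ` is
continuous with a nonzero derivative at `c`, and `U Vᵀ` may have rank one. -/
structure Usable (ρ : ℝ → ℝ) (c : ℝ) (r : ℕ) : Prop where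
  cont : Continuous ρ
  diff : DifferentiableAt ℝ ρ c
  deriv_ne : deriv ρ c ≠ 0
  one_le : 1 ≤ r

theorem Usable.rankOne (H : Usable ρ c r) (α : ℝ) (u v b : Fin N → ℝ) :
    Admissible ρ r fun z i => α * z i + u i * (v ⬝ᵥ z) + b i :=
  Admissible.rankOne H.diff H.deriv_ne H.one_le α u v b

theorem admissible_update_dotProduct (H : Usable ρ c r) (i : Fin N) (w : Fin N → ℝ) (b : ℝ) :
    Admissible ρ r fun z => update z i (w ⬝ᵥ z + b) := by
  refine (H.rankOne 1 (Pi.single i 1) (w - Pi.single i 1) (Pi.single i b)).congr fun z => ?_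
  funext k
  by_cases hk : k = i
  · subst hk
    simp [sub_dotProduct]
  · simp [hk]

/-- The activation can be applied to a single coordinate: on the others it is made close to the
identity by diagonal scalings that differ from a multiple of `I` in one entry only. -/
theorem admissible_update_activation (H : Usable ρ c r) (i : Fin N) :
    Admissible ρ r fun z => update z i (ρ (z i)) := by
  refine Admissible.of_limit fun R ε hε => ?_
  obtain ⟨h, a, b, hid⟩ := exists_identity_approx H.diff H.deriv_ne R hε
  refine ⟨_, (H.rankOne a (Pi.single i 1) (Pi.single i (1 - a)) (update (fun _ => b) i 0)).comp
    ((Admissible.activation H.cont H.one_le).comp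
      (H.rankOne h (Pi.single i 1) (Pi.single i (1 - h)) (update (fun _ => c) i 0))),
    fun z hz => ?_⟩
  refine (pi_norm_le_iff_of_nonneg hε.le).2 fun k => ?_
  by_cases hk : k = i
  · subst hk
    simp only [single_dotProduct, Pi.single_eq_same, update_self, Pi.sub_apply]
    rw [show h * z k + 1 * ((1 - h) * z k) + 0 = z k by ring,
      show a * ρ (z k) + 1 * ((1 - a) * ρ (z k)) + 0 - ρ (z k) = 0 by ring]
    simpa using hε.le
  · simpa [hk] using hid (z k) ((norm_le_pi_norm z k).trans hz)

theorem admissible_shear_ridge (H : Usable ρ c r) {τ i : Fin N} (hi : i ≠ τ) (a b : ℝ)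
    (w : Fin N → ℝ) : Admissible ρ r (shear τ i fun z => a * ρ (w ⬝ᵥ z + b)) := by
  refine ((admissible_update_dotProduct H τ 0 0).comp
    ((admissible_update_dotProduct H i (Pi.single i 1 + Pi.single τ a) 0).comp
    ((admissible_update_activation H τ).comp (admissible_update_dotProduct H τ w b)))).congr
    fun z => ?_
  funext k
  by_cases hk : k = τ
  · subst hk
    simp [shear]
  · by_cases hki : k = i
    · subst hki
      simp [shear, hk, add_dotProduct]
    · simp [shear, hk, hki]

theorem admissible_shear_const (H : Usable ρ c r) (τ i : Fin N) (a : ℝ) :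
    Admissible ρ r (shear τ i fun _ => a) := by
  refine ((admissible_update_dotProduct H τ 0 0).comp
    (admissible_update_dotProduct H i (Pi.single i 1) a)).congr fun z => ?_
  simp [shear]

/-- Shears along the same coordinate add up, if the second one is by a function that does not
depend on the coordinates changed by the first one. -/
theorem admissible_shear_add {τ i : Fin N} (hi : i ≠ τ) {f g : (Fin N → ℝ) → ℝ}
    (hf : Admissible ρ r (shear τ i f)) (hg : Admissible ρ r (shear τ i g))
    (hgf : ∀ z, g (shear τ i f z) = g z) : Admissible ρ r (shear τ i fun z => f z + g z) := by
  refine (hg.comp hf).congr fun z => ?_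
  rw [shear, shear, hgf]
  funext k
  by_cases hk : k = τ
  · subst hk
    simp
  · by_cases hki : k = i
    · subst hki
      simp [shear, hk, add_assoc]
    · simp [shear, hk, hki]

theorem admissible_shear_of_limit {τ i : Fin N} {g : (Fin N → ℝ) → ℝ}
    (h : ∀ R : ℝ, ∀ ε > 0, ∃ f, Admissible ρ r (shear τ i f) ∧ ∀ z, ‖z‖ ≤ R → |f z - g z| ≤ ε) :
    Admissible ρ r (shear τ i g) := by
  refine Admissible.of_limit fun R ε hε => ?_
  obtain ⟨f, hf, hfg⟩ := h R ε hε
  refine ⟨_, hf, fun z hz => (pi_norm_le_iff_of_nonneg hε.le).2 fun k => ?_⟩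
  by_cases hk : k = τ
  · subst hk
    simpa [shear] using hε.le
  · by_cases hki : k = i
    · subst hki
      simpa [shear, hk] using hfg z hz
    · simpa [shear, hk, hki] using hε.le

theorem dotProduct_shear {τ i : Fin N} {w : Fin N → ℝ} (hwi : w i = 0) (hwτ : w τ = 0)
    (f : (Fin N → ℝ) → ℝ) (z : Fin N → ℝ) : w ⬝ᵥ shear τ i f z = w ⬝ᵥ z := by
  refine Finset.sum_congr rfl fun k _ => ?_
  by_cases hk : k = τ
  · subst hk
    simp [hwτ]
  · by_cases hki : k = i
    · subst hki
      simp [hwi]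
    · simp [shear, hk, hki]

theorem admissible_shear_ridgeSpan (H : Usable ρ c r) {τ i : Fin N} (hi : i ≠ τ)
    {w : Fin N → ℝ} (hwi : w i = 0) (hwτ : w τ = 0) {f : ℝ → ℝ} (hf : f ∈ ridgeSpan ρ) (a : ℝ) :
    Admissible ρ r (shear τ i fun z => a * f (w ⬝ᵥ z)) := by
  unfold ridgeSpan at hf
  induction hf using Submodule.span_induction generalizing a with
  | mem f hf =>
    obtain ⟨p, rfl⟩ := hf
    simpa using admissible_shear_ridge H hi a p.2 (p.1 • w)
  | zero => simpa using admissible_shear_const H τ i 0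
  | add f g _ _ hf hg =>
    simp only [Pi.add_apply, mul_add]
    exact admissible_shear_add hi (hf a) (hg a) fun z => by rw [dotProduct_shear hwi hwτ]
  | smul b f _ hf => simpa [mul_assoc] using hf (a * b)

theorem admissible_shear_sq (H : Usable ρ c r)
    (hna : ¬ ∃ a b : ℝ, ∀ x : ℝ, ρ x = a * x + b) {τ i : Fin N} (hi : i ≠ τ)
    {w : Fin N → ℝ} (hwi : w i = 0) (hwτ : w τ = 0) (a : ℝ) :
    Admissible ρ r (shear τ i fun z => a * (w ⬝ᵥ z) ^ 2) := by
  refine admissible_shear_of_limit fun R ε hε => ?_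
  have hcont : Continuous fun z : Fin N → ℝ => w ⬝ᵥ z := by
    unfold dotProduct
    fun_prop
  obtain ⟨R', hR'⟩ := hcont.exists_norm_le R
  obtain ⟨f, hf, h⟩ := mem_ridgeClosure.1
    (Submodule.smul_mem _ a (sq_mem_ridgeClosure H.cont hna)) R' ε hε
  refine ⟨fun z => 1 * f (w ⬝ᵥ z), admissible_shear_ridgeSpan H hi hwi hwτ hf 1, fun z hz => ?_⟩
  simpa using h (w ⬝ᵥ z) (hR' z hz)

theorem admissible_shear_mul (H : Usable ρ c r)
    (hna : ¬ ∃ a b : ℝ, ∀ x : ℝ, ρ x = a * x + b) {τ i j k : Fin N} (hi : i ≠ τ)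
    (hji : j ≠ i) (hjτ : j ≠ τ) (hki : k ≠ i) (hkτ : k ≠ τ) (a : ℝ) :
    Admissible ρ r (shear τ i fun z => a * (z j * z k)) := by
  have h1 := admissible_shear_sq H hna hi (w := Pi.single j 1 + Pi.single k 1)
    (by simp [hji.symm, hki.symm]) (by simp [hjτ.symm, hkτ.symm]) (a / 4)
  have h2 := admissible_shear_sq H hna hi (w := Pi.single j 1 - Pi.single k 1)
    (by simp [hji.symm, hki.symm]) (by simp [hjτ.symm, hkτ.symm]) (-(a / 4))
  have h3 := admissible_shear_add hi h1 h2 fun z => by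
    rw [dotProduct_shear (by simp [hji.symm, hki.symm]) (by simp [hjτ.symm, hkτ.symm])]
  convert h3 using 3 with z
  simp only [add_dotProduct, sub_dotProduct, single_dotProduct]
  ring

/-! ### Polynomials of the input registers -/

/-- The multiples of `f` can be added to every register, that is, to every coordinate outside the
set `X` of input coordinates and the scratch coordinate `τ`. -/
def Addable (ρ : ℝ → ℝ) (r : ℕ) (X : Set (Fin N)) (τ : Fin N) (f : (Fin N → ℝ) → ℝ) : Prop :=
  ∀ i, i ∉ X → i ≠ τ → ∀ a : ℝ, Admissible ρ r (shear τ i fun z => a * f z)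

theorem shear_apply_of_ne {τ i k : Fin N} (hkτ : k ≠ τ) (hki : k ≠ i) (g : (Fin N → ℝ) → ℝ)
    (z : Fin N → ℝ) : shear τ i g z k = z k := by
  simp [shear, hkτ, hki]

theorem shear_apply_self {τ i : Fin N} (hi : i ≠ τ) (g : (Fin N → ℝ) → ℝ)
    (z : Fin N → ℝ) : shear τ i g z i = z i + g z := by
  simp [shear, hi]

theorem shear_apply_scratch (τ i : Fin N) (g : (Fin N → ℝ) → ℝ)
    (z : Fin N → ℝ) : shear τ i g z τ = 0 := by
  simp [shear]

/-- With a second register `j`, the sequence `z i -= a z j z k`, `z j += f z`, `z i += a z j z k`,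
`z j -= f z` adds `a f z z k` to `z i` and leaves `z j` unchanged. -/
theorem Addable.mul_coord (H : Usable ρ c r)
    (hna : ¬ ∃ a b : ℝ, ∀ x : ℝ, ρ x = a * x + b) {X : Set (Fin N)} {τ : Fin N} (hτ : τ ∉ X)
    (hreg : ∀ i, ∃ j, j ∉ X ∧ j ≠ τ ∧ j ≠ i) {f : (Fin N → ℝ) → ℝ}
    (hfX : ∀ z z', (∀ k ∈ X, z k = z' k) → f z = f z') (hf : Addable ρ r X τ f)
    {k : Fin N} (hk : k ∈ X) : Addable ρ r X τ fun z => f z * z k := by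
  intro i hiX hi a
  obtain ⟨j, hjX, hj, hji⟩ := hreg i
  have hkτ : k ≠ τ := ne_of_mem_of_not_mem hk hτ
  have hki : k ≠ i := ne_of_mem_of_not_mem hk hiX
  have hkj : k ≠ j := ne_of_mem_of_not_mem hk hjX
  have hff : ∀ (l : Fin N) (g : (Fin N → ℝ) → ℝ) z, l ∉ X → f (shear τ l g z) = f z :=
    fun l g z hl => hfX _ _ fun q hq =>
      shear_apply_of_ne (ne_of_mem_of_not_mem hq hτ) (ne_of_mem_of_not_mem hq hl) _ _
  refine (((hf j hjX hj (-1)).comp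
    (admissible_shear_mul H hna hi hji hj hki hkτ a)).comp ((hf j hjX hj 1).comp
    (admissible_shear_mul H hna hi hji hj hki hkτ (-a)))).congr fun z => ?_
  funext q
  by_cases hqτ : q = τ
  · subst hqτ
    simp only [shear_apply_scratch]
  by_cases hqi : q = i
  · subst hqi
    rw [shear_apply_self hi, shear_apply_of_ne hi hji.symm, shear_apply_self hi,
      shear_apply_of_ne hi hji.symm, shear_apply_self hi, shear_apply_self hj,
      shear_apply_of_ne hkτ hkj, shear_apply_of_ne hkτ hki, shear_apply_of_ne hj hji,
      hff _ _ _ hiX]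
    ring
  by_cases hqj : q = j
  · subst hqj
    rw [shear_apply_of_ne hqτ hqi, shear_apply_self hqτ, shear_apply_of_ne hqτ hqi,
      shear_apply_self hqτ, shear_apply_of_ne hqτ hqi]
    simp only [hff _ _ _ hiX, hff _ _ _ hjX]
    ring
  · simp only [shear_apply_of_ne hqτ hqi, shear_apply_of_ne hqτ hqj]

theorem addable_mvPolynomial (H : Usable ρ c r)
    (hna : ¬ ∃ a b : ℝ, ∀ x : ℝ, ρ x = a * x + b) {ι : Type*} (e : ι → Fin N) {τ : Fin N}
    (hτ : τ ∉ range e) (hreg : ∀ i, ∃ j, j ∉ range e ∧ j ≠ τ ∧ j ≠ i) (p : MvPolynomial ι ℝ) :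
    Addable ρ r (range e) τ fun z => MvPolynomial.eval (fun k => z (e k)) p := by
  have hX : ∀ (p : MvPolynomial ι ℝ) (z z' : Fin N → ℝ), (∀ k ∈ range e, z k = z' k) →
      MvPolynomial.eval (fun k => z (e k)) p = MvPolynomial.eval (fun k => z' (e k)) p := by
    intro p z z' h
    rw [show (fun k => z (e k)) = fun k => z' (e k) from funext fun k => h _ ⟨k, rfl⟩]
  induction p using MvPolynomial.induction_on with
  | C b =>
    intro i _ hi a
    simpa using admissible_shear_const H τ i (a * b)
  | add p q hp hq =>
    intro i hiX hi a
    simp only [map_add, mul_add]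
    refine admissible_shear_add hi (hp i hiX hi a) (hq i hiX hi a) fun z => ?_
    rw [hX q _ z fun k hk => shear_apply_of_ne (ne_of_mem_of_not_mem hk hτ)
      (ne_of_mem_of_not_mem hk hiX) _ _]
  | mul_X p k hp =>
    simp only [map_mul, MvPolynomial.eval_X]
    exact hp.mul_coord H hna hτ hreg (hX p) ⟨k, rfl⟩

/-- Polynomials of the inputs can be added to several registers at once. -/
theorem exists_admissible_polynomials (H : Usable ρ c r)
    (hna : ¬ ∃ a b : ℝ, ∀ x : ℝ, ρ x = a * x + b) {ι κ : Type*} [Fintype κ] (e : ι → Fin N)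
    (y : κ → Fin N) (hy : Injective y) {τ : Fin N} (hτ : τ ∉ range e)
    (hye : ∀ j, y j ∉ range e) (hyτ : ∀ j, y j ≠ τ)
    (hreg : ∀ i, ∃ j, j ∉ range e ∧ j ≠ τ ∧ j ≠ i) (p : κ → MvPolynomial ι ℝ) :
    ∃ T, Admissible ρ r T ∧
      ∀ z j, T z (y j) = z (y j) + MvPolynomial.eval (fun k => z (e k)) (p j) := by
  classical
  suffices h : ∀ s : Finset κ, ∃ T, Admissible ρ r T ∧ (∀ z k, T z (e k) = z (e k)) ∧
      ∀ z j, T z (y j)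
        = z (y j) + if j ∈ s then MvPolynomial.eval (fun k => z (e k)) (p j) else 0 by
    obtain ⟨T, hT, -, h⟩ := h Finset.univ
    exact ⟨T, hT, by simpa using h⟩
  intro s
  induction s using Finset.induction_on with
  | empty => exact ⟨id, fun S F hF => hF, by simp, by simp⟩
  | insert l s hl ih =>
    obtain ⟨T, hT, hTe, hTy⟩ := ih
    refine ⟨_, (addable_mvPolynomial H hna e hτ hreg (p l) (y l) (hye l) (hyτ l) 1).comp hT,
      fun z k => ?_, fun z j => ?_⟩
    · rw [shear_apply_of_ne (fun h => hτ ⟨k, h⟩) (fun h => hye l ⟨k, h⟩), hTe]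
    · by_cases hj : j = l
      · subst hj
        rw [shear_apply_self (hyτ j), hTy]
        simp [hl, hTe]
      · rw [shear_apply_of_ne (hyτ j) (fun h => hj (hy h)), hTy]
        simp [hj]

end Shear

/-! ### Permutations of the coordinates -/

/-- A transposition matrix is `I - d dᵀ` with `d = eₖ - eₗ`, hence a layer of rank one. -/
theorem admissible_perm {N r : ℕ} {ρ : ℝ → ℝ} {c : ℝ} (H : Usable ρ c r)
    (σ : Equiv.Perm (Fin N)) : Admissible ρ r fun z i => z (σ i) := by
  induction σ using Equiv.Perm.swap_induction_on with
  | one => exact fun S F hF => hF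
  | swap_mul σ k l hkl ih =>
    refine (ih.comp (H.rankOne 1 (Pi.single k 1 - Pi.single l 1)
      (Pi.single l 1 - Pi.single k 1) 0)).congr fun z => ?_
    funext i
    simp only [Equiv.Perm.mul_apply, sub_dotProduct, single_dotProduct, Pi.sub_apply,
      Pi.zero_apply]
    by_cases h1 : σ i = k
    · simp [h1, hkl]
    · by_cases h2 : σ i = l
      · simp [h2, hkl.symm]
      · simp [h1, h2, Equiv.swap_apply_of_ne_of_ne]

/-! ### Density -/

theorem exists_mvPolynomial_approx {n : ℕ} {K : Set (Fin n → ℝ)} (hK : IsCompact K)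
    (g : C(K, ℝ)) {ε : ℝ} (hε : 0 < ε) :
    ∃ p : MvPolynomial (Fin n) ℝ, ∀ x : K, |MvPolynomial.eval (x : Fin n → ℝ) p - g x| < ε := by
  have := isCompact_iff_compactSpace.1 hK
  let X : Fin n → C(K, ℝ) := fun k =>
    ⟨fun x => (x : Fin n → ℝ) k, (continuous_apply k).comp continuous_subtype_val⟩
  have hX : ∀ (p : MvPolynomial (Fin n) ℝ) (x : K),
      MvPolynomial.aeval X p x = MvPolynomial.eval (x : Fin n → ℝ) p := by
    intro p x
    induction p using MvPolynomial.induction_on with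
    | C b => simp
    | add p q hp hq => simp [hp, hq]
    | mul_X p k hp => simp [hp, X]
  have hsep : (MvPolynomial.aeval (R := ℝ) X).range.SeparatesPoints := by
    intro x x' hx
    obtain ⟨k, hk⟩ := Function.ne_iff.1 fun h => hx (Subtype.ext h)
    exact ⟨_, ⟨X k, ⟨MvPolynomial.X k, by simp⟩, rfl⟩, hk⟩
  obtain ⟨⟨_, p, rfl⟩, hf⟩ :=
    ContinuousMap.exists_mem_subalgebra_near_continuousMap_of_separatesPoints _ hsep g ε hε
  refine ⟨p, fun x => ?_⟩
  rw [← hX]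
  exact (ContinuousMap.norm_coe_le_norm (MvPolynomial.aeval X p - g) x).trans_lt hf

/-- The coordinates of the state are the `n` inputs, then `m` outputs, one more register, and the
scratch coordinate; at the end a cyclic shift brings the outputs to the front. -/
theorem exists_network_approx {n m r : ℕ} {ρ : ℝ → ℝ} {c : ℝ} (H : Usable ρ c r)
    (hna : ¬ ∃ a b : ℝ, ∀ x : ℝ, ρ x = a * x + b) {K : Set (Fin n → ℝ)} (hK : IsCompact K)
    (p : Fin m → MvPolynomial (Fin n) ℝ) {ε : ℝ} (hε : 0 < ε) :
    ∃ net : DLoRNetwork (n + m + 2) r, ∀ x ∈ K, ∀ j,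
      |net.realize ρ x j - MvPolynomial.eval x (p j)| ≤ ε := by
  rcases Nat.eq_zero_or_pos m with rfl | hm
  · exact ⟨⟨[], DLoRLayer.rankOne r 0 0 0 0⟩, fun x _ j => j.elim0⟩
  let e : Fin n → Fin (n + m + 2) := fun k => ⟨k, by omega⟩
  let y : Fin m → Fin (n + m + 2) := fun j => ⟨n + j, by omega⟩
  let t : Fin (n + m + 2) := ⟨n + m, by omega⟩
  let τ : Fin (n + m + 2) := ⟨n + m + 1, by omega⟩
  have hne : ∀ i : Fin (n + m + 2), n ≤ i → i ∉ range e := by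
    rintro _ hi ⟨k, rfl⟩
    exact absurd hi (not_le.2 k.2)
  obtain ⟨T, hT, hTy⟩ := exists_admissible_polynomials H hna e y
    (fun i j hij => Fin.ext (by simpa [y] using hij)) (τ := τ)
    (hne τ (by simp only [τ]; omega)) (fun j => hne _ (by simp [y]))
    (fun j h => by simp only [y, τ, Fin.mk.injEq] at h; omega) (by
      intro i
      by_cases hi : i = t
      · refine ⟨y ⟨0, hm⟩, hne _ (by simp [y]), fun h => ?_, fun h => ?_⟩
        · simp only [y, τ, Fin.mk.injEq] at h
          omega
        · simp only [hi, y, t, Fin.mk.injEq] at h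
          omega
      · exact ⟨t, hne _ (by simp [t]), fun h => by simp [t, τ] at h, fun h => hi h.symm⟩) p
  let S := DLoRNetwork.pad (n + m + 2) '' K
  have hid : Realizable ρ r S fun z => z := by
    refine ⟨(hK.image (DLoRNetwork.continuous_pad _)).isBounded.exists_norm_le, fun ε hε =>
      ⟨⟨[], DLoRLayer.rankOne r 1 0 0 0⟩, fun z _ => ?_⟩⟩
    simp only [DLoRNetwork.eval, DLoRNetwork.hiddenState, List.foldl_nil,
      DLoRLayer.rankOne_affine H.one_le]
    simpa using hε.le
  obtain ⟨net, hnet⟩ :=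
    ((admissible_perm H (Equiv.addRight (⟨n, by omega⟩ : Fin (n + m + 2)))).comp hT _ _ hid).2 ε hε
  refine ⟨net, fun x hx j => ?_⟩
  have h := (norm_le_pi_norm _ (Fin.castLE (by omega) j)).trans (hnet _ ⟨x, hx, rfl⟩)
  have hσ : (Equiv.addRight (⟨n, by omega⟩ : Fin (n + m + 2)))
      (Fin.castLE (by omega : m ≤ n + m + 2) j) = y j := by
    ext
    simp only [Equiv.coe_addRight, Fin.val_add, Fin.val_castLE, y]
    rw [Nat.mod_eq_of_lt (by omega), add_comm]
  have hy0 : DLoRNetwork.pad (n + m + 2) x (y j) = 0 := by simp [DLoRNetwork.pad, y]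
  have hxe : (fun k => DLoRNetwork.pad (n + m + 2) x (e k)) = x := by
    funext k
    simp [DLoRNetwork.pad, e]
  rw [Pi.sub_apply] at h
  beta_reduce at h
  rw [hσ, hTy, hy0, zero_add, hxe] at h
  exact h

/-- Density is with respect to the compact-open topology of `C(K, ℝᵐ)`, which for compact `K` is
the topology of the uniform norm. -/
theorem theorem5p1 (n m r : ℕ) (hr : 1 ≤ r) (ρ : ℝ → ℝ)
    (hρ_cont : Continuous ρ)
    (hρ_nonaffine : ¬ ∃ a b : ℝ, ∀ x : ℝ, ρ x = a * x + b)
    (c : ℝ)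
    (hρ_diff : ∀ᶠ x in nhds c, DifferentiableAt ℝ ρ x)
    (hρ_deriv_cont : ContinuousAt (deriv ρ) c)
    (hρ_deriv_ne : deriv ρ c ≠ 0)
    (K : Set (Fin n → ℝ)) (hK : IsCompact K) :
    Dense (deepDLoRClass m r ρ K) := by
  have := isCompact_iff_compactSpace.1 hK
  refine Metric.dense_iff.2 fun g ε hε => ?_
  have hgj : ∀ j, ∃ p : MvPolynomial (Fin n) ℝ, ∀ x : K,
      |MvPolynomial.eval (x : Fin n → ℝ) p - g x j| < ε / 4 := fun j =>
    exists_mvPolynomial_approx hK ⟨fun x => g x j, (continuous_apply j).comp g.continuous⟩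
      (by positivity)
  choose p hp using hgj
  obtain ⟨net, hnet⟩ := exists_network_approx ⟨hρ_cont, hρ_diff.self_of_nhds, hρ_deriv_ne, hr⟩
    hρ_nonaffine hK p (ε := ε / 4) (by positivity)
  let f : C(K, Fin m → ℝ) := ⟨fun x => net.realize ρ (x : Fin n → ℝ), continuous_pi fun j =>
    (continuous_apply _).comp ((net.continuous_eval hρ_cont).comp
      ((DLoRNetwork.continuous_pad _).comp continuous_subtype_val))⟩
  refine ⟨f, ?_, net, fun x => rfl⟩
  refine lt_of_le_of_lt ((ContinuousMap.dist_le (half_pos hε).le).2 fun x =>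
    (dist_pi_le_iff (half_pos hε).le).2 fun j => ?_) (half_lt_self hε)
  have h1 := abs_le.1 (hnet x x.2 j)
  have h2 := abs_lt.1 (hp j x)
  rw [Real.dist_eq]
  exact abs_le.2 ⟨by simp only [f, ContinuousMap.coe_mk]; linarith,
    by simp only [f, ContinuousMap.coe_mk]; linarith⟩
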